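/- Let $\mathbb{D}=\{w\in\mathbb{C}:|w|<1\}$. For a sequence $\alpha=(\alpha_n)_{n\in\mathbb{Z}}$ in $\mathbb{D}$, put $\rho_n=(1-|\alpha_n|^2)^{1/2}$ and let $\mathcal{E}_\alpha$ be the extended CMV matrix with Verblunsky coefficients $\alpha$, i.e. the bounded operator on $\ell^2(\mathbb{Z})$ given by $$(\mathcal{E}_\alpha\psi)_n=\bar\alpha_n\rho_{n-1}\psi_{n-1}-\bar\alpha_n\alpha_{n-1}\psi_n+\bar\alpha_{n+1}\rho_n\psi_{n+1}+\rho_{n+1}\rho_n\psi_{n+2}\quad (n \text{ even}),$$ $$(\mathcal{E}_\alpha\psi)_n=\rho_{n-1}\rho_{n-2}\psi_{n-2}-\rho_{n-1}\alpha_{n-2}\psi_{n-1}-\bar\alpha_n\alpha_{n-1}\psi_n-\rho_n\alpha_{n-1}\psi_{n+1}\quad (n \text{ odd}).$$ Let $\nu$ be a Borel probability measure on $\mathbb{D}$ whose topological support $\operatorname{supp}\nu$ is a compact subset of $\mathbb{D}$, let $\Omega=(\operatorname{supp}\nu)^{\mathbb{Z}}$, and let $\mu=\nu^{\mathbb{Z}}$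 be the product measure, which is carried by $\Omega$. Then there is a unique closed set $\Sigma_\mu\subseteq\partial\mathbb{D}$ (the almost sure spectrum) such that $\sigma(\mathcal{E}_\omega)=\Sigma_\mu$ for $\mu$-almost every $\omega$. Moreover, for any two non-decreasing sequences of natural numbers $(l_k)_{k}$ and $(r_k)_{k}$ with $l_k\to\infty$ and $r_k\to\infty$, for $\mu$-almost every $\omega\in\Omega$, $$\Sigma_\mu=\overline{\bigcup_k\sigma(\mathcal{E}_{\omega,(l_k,r_k)})},$$ where $\mathcal{E}_{\omega,(l,r)}$ is the extended CMV matrix whose Verblunsky coefficients form the $(l+r+1)$-periodic sequence that agrees with $\omega$ on $\{-l,\dots,r\}$, i.e. the periodic sequence with unit cell $(\omega_{-l},\dots,\omega_r)$. -/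

import Mathlib

open Filter MeasureTheory

noncomputable section

namespace RandomCMV

/-- The open unit disk `𝔻 = {w : |w| < 1}`, with the subspace topology and Borel structure. -/
abbrev Disk : Type := Metric.ball (0 : ℂ) 1

/-- The Hilbert space `ℓ²(ℤ)`. -/
abbrev EllTwo : Type := lp (fun _ : ℤ => ℂ) 2

/-- `ρ = (1 - |α|²)^{1/2}`, as a complex number. -/
def rho (a : Disk) : ℂ := ((Real.sqrt (1 - ‖(a : ℂ)‖ ^ 2) : ℝ) : ℂ)

/-- The action `ψ ↦ ℰψ` of the extended CMV matrix on a two-sided sequence, that is, the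
five-diagonal matrix whose rows are, for even `n`,
`(conj αₙ ρₙ₋₁, -conj αₙ αₙ₋₁, conj αₙ₊₁ ρₙ, ρₙ₊₁ ρₙ)` in the columns `n-1, n, n+1, n+2`, and for
odd `n`,
`(ρₙ₋₁ ρₙ₋₂, -ρₙ₋₁ αₙ₋₂, -conj αₙ αₙ₋₁, -ρₙ αₙ₋₁)` in the columns `n-2, n-1, n, n+1`. -/
def cmvAction (a : ℤ → Disk) (ψ : ℤ → ℂ) (n : ℤ) : ℂ :=
  if Even n then
    star (a n : ℂ) * rho (a (n - 1)) * ψ (n - 1)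
      + -(star (a n : ℂ) * (a (n - 1) : ℂ)) * ψ n
      + star (a (n + 1) : ℂ) * rho (a n) * ψ (n + 1)
      + rho (a (n + 1)) * rho (a n) * ψ (n + 2)
  else
    rho (a (n - 1)) * rho (a (n - 2)) * ψ (n - 2)
      + -(rho (a (n - 1)) * (a (n - 2) : ℂ)) * ψ (n - 1)
      + -(star (a n : ℂ) * (a (n - 1) : ℂ)) * ψ n
      + -(rho (a n) * (a (n - 1) : ℂ)) * ψ (n + 1)

theorem norm_coe_le (a : Disk) : ‖(a : ℂ)‖ ≤ 1 := by
  have h := a.2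
  rw [mem_ball_zero_iff] at h
  exact h.le

theorem norm_rho_le (a : Disk) : ‖rho a‖ ≤ 1 := by
  rw [rho, Complex.norm_real, Real.norm_of_nonneg (Real.sqrt_nonneg _), Real.sqrt_le_one]
  linarith [sq_nonneg ‖(a : ℂ)‖]

theorem norm_mul_mul_le {x y z : ℂ} (hx : ‖x‖ ≤ 1) (hy : ‖y‖ ≤ 1) : ‖x * y * z‖ ≤ ‖z‖ := by
  rw [norm_mul, norm_mul]
  exact mul_le_of_le_one_left (norm_nonneg _) (mul_le_one₀ hx (norm_nonneg _) hy)

theorem norm_cmvAction_le (a : ℤ → Disk) (ψ : ℤ → ℂ) (n : ℤ) :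
    ‖cmvAction a ψ n‖ ≤
      ‖ψ (n - 2)‖ + ‖ψ (n - 1)‖ + ‖ψ n‖ + ‖ψ (n + 1)‖ + ‖ψ (n + 2)‖ := by
  have hA := fun m => norm_coe_le (a m)
  have hS : ∀ m, ‖star (a m : ℂ)‖ ≤ 1 := fun m => by rw [norm_star]; exact hA m
  have hR := fun m => norm_rho_le (a m)
  unfold cmvAction
  split_ifs
  · have h1 := norm_mul_mul_le (z := ψ (n - 1)) (hS n) (hR (n - 1))
    have h2 := norm_mul_mul_le (z := ψ n) (hS n) (hA (n - 1))
    have h3 := norm_mul_mul_le (z := ψ (n + 1)) (hS (n + 1)) (hR n)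
    have h4 := norm_mul_mul_le (z := ψ (n + 2)) (hR (n + 1)) (hR n)
    refine (norm_add₄_le).trans ?_
    rw [neg_mul, norm_neg]
    linarith [norm_nonneg (ψ (n - 2))]
  · have h1 := norm_mul_mul_le (z := ψ (n - 2)) (hR (n - 1)) (hR (n - 2))
    have h2 := norm_mul_mul_le (z := ψ (n - 1)) (hR (n - 1)) (hA (n - 2))
    have h3 := norm_mul_mul_le (z := ψ n) (hS n) (hA (n - 1))
    have h4 := norm_mul_mul_le (z := ψ (n + 1)) (hR n) (hA (n - 1))
    refine (norm_add₄_le).trans ?_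
    rw [neg_mul, norm_neg, neg_mul, norm_neg, neg_mul, norm_neg]
    linarith [norm_nonneg (ψ (n + 2))]

theorem hasSum_shift (ψ : EllTwo) (k : ℤ) :
    HasSum (fun n : ℤ => ‖ψ (n + k)‖ ^ 2) (‖ψ‖ ^ 2) := by
  have h := lp.hasSum_norm (p := 2) (by norm_num) ψ
  simp only [ENNReal.toReal_ofNat, Real.rpow_ofNat] at h
  exact (Equiv.addRight k).hasSum_iff.mpr h

theorem hasSum_band (ψ : EllTwo) :
    HasSum (fun n : ℤ => 5 * (‖ψ (n - 2)‖ ^ 2 + ‖ψ (n - 1)‖ ^ 2 + ‖ψ n‖ ^ 2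
      + ‖ψ (n + 1)‖ ^ 2 + ‖ψ (n + 2)‖ ^ 2)) ((5 * ‖ψ‖) ^ 2) := by
  have h0 := hasSum_shift ψ 0
  simp only [add_zero] at h0
  have h := (((((hasSum_shift ψ (-2)).add (hasSum_shift ψ (-1))).add h0).add
    (hasSum_shift ψ 1)).add (hasSum_shift ψ 2)).mul_left 5
  have e : 5 * (‖ψ‖ ^ 2 + ‖ψ‖ ^ 2 + ‖ψ‖ ^ 2 + ‖ψ‖ ^ 2 + ‖ψ‖ ^ 2) = (5 * ‖ψ‖) ^ 2 := by ring
  rw [e] at h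
  simpa only [← sub_eq_add_neg] using h

theorem norm_sq_cmvAction_le (a : ℤ → Disk) (ψ : ℤ → ℂ) (n : ℤ) :
    ‖cmvAction a ψ n‖ ^ 2 ≤ 5 * (‖ψ (n - 2)‖ ^ 2 + ‖ψ (n - 1)‖ ^ 2 + ‖ψ n‖ ^ 2
      + ‖ψ (n + 1)‖ ^ 2 + ‖ψ (n + 2)‖ ^ 2) := by
  have h := pow_le_pow_left₀ (norm_nonneg _) (norm_cmvAction_le a ψ n) 2
  refine h.trans ?_
  generalize ‖ψ (n - 2)‖ = p, ‖ψ (n - 1)‖ = q, ‖ψ n‖ = r, ‖ψ (n + 1)‖ = s, ‖ψ (n + 2)‖ = t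
  linarith [sq_nonneg (p - q), sq_nonneg (p - r), sq_nonneg (p - s), sq_nonneg (p - t),
    sq_nonneg (q - r), sq_nonneg (q - s), sq_nonneg (q - t), sq_nonneg (r - s),
    sq_nonneg (r - t), sq_nonneg (s - t)]

theorem memℓp_cmvAction (a : ℤ → Disk) (ψ : EllTwo) :
    Memℓp (E := fun _ : ℤ => ℂ) (cmvAction a ψ) 2 := by
  refine memℓp_gen ?_
  simp only [ENNReal.toReal_ofNat, Real.rpow_ofNat]
  exact Summable.of_nonneg_of_le (fun _ => by positivity) (norm_sq_cmvAction_le a ψ)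
    (hasSum_band ψ).summable

/-- The extended CMV matrix `ℰ` with Verblunsky coefficients `(aₙ)_{n ∈ ℤ}`, as a bounded
operator on `ℓ²(ℤ)`. -/
def extendedCMV (a : ℤ → Disk) : EllTwo →L[ℂ] EllTwo :=
  LinearMap.mkContinuous
    { toFun := fun ψ => ⟨cmvAction a ψ, memℓp_cmvAction a ψ⟩
      map_add' := fun ψ φ => by
        ext n
        simp only [cmvAction, lp.coeFn_add, Pi.add_apply]
        split_ifs <;> ring
      map_smul' := fun c ψ => by
        ext n
        simp only [cmvAction, lp.coeFn_smul, Pi.smul_apply, smul_eq_mul, RingHom.id_apply]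
        split_ifs <;> simp <;> ring }
    5 (fun ψ => by
      refine lp.norm_le_of_tsum_le (p := 2) (by norm_num) (by positivity) ?_
      simp only [ENNReal.toReal_ofNat, Real.rpow_ofNat]
      rw [← (hasSum_band ψ).tsum_eq]
      exact Summable.tsum_le_tsum (norm_sq_cmvAction_le a ψ)
        (Summable.of_nonneg_of_le (fun _ => by positivity) (norm_sq_cmvAction_le a ψ)
          (hasSum_band ψ).summable) (hasSum_band ψ).summable)

theorem extendedCMV_apply (a : ℤ → Disk) (ψ : EllTwo) (n : ℤ) :
    extendedCMV a ψ n = cmvAction a ψ n := rfl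

/-- The `(l + r + 1)`-periodic sequence that agrees with `ω` on `{-l, …, r}`: its unit cell is
`(ω₋ₗ, …, ωᵣ)`. -/
def periodize (ω : ℤ → Disk) (l r : ℕ) (n : ℤ) : Disk :=
  ω ((n + l) % ((l : ℤ) + r + 1) - l)

/-- The measure `μ = ν^ℤ`, the law of independent coefficients `(ωₙ)_{n ∈ ℤ}` with common
distribution `ν`. It is carried by `Ω = (supp ν)^ℤ`. -/
def coeffLaw (ν : Measure Disk) : Measure (ℤ → Disk) := Measure.infinitePi (fun _ : ℤ => ν)

/-- `S` is an almost sure spectrum: a closed subset of the unit circle such that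
`σ(ℰ_ω) = S` for `μ`-almost every `ω`. -/
def IsAlmostSureSpectrum (ν : Measure Disk) (S : Set ℂ) : Prop :=
  IsClosed S ∧ S ⊆ Metric.sphere (0 : ℂ) 1 ∧
    ∀ᵐ ω ∂(coeffLaw ν), spectrum ℂ (extendedCMV ω) = S

end RandomCMV

end

open Filter MeasureTheory

open scoped Topology ENNReal

noncomputable section

namespace RandomCMV

/-! ### Approximate eigenvalues of normal operators -/

section Spectrum

variable {H : Type*} [NormedAddCommGroup H] [InnerProductSpace ℂ H] [CompleteSpace H]

/-! Almost every `ω` has all its coefficients in `supp ν` and even translates dense in `(supp ν)^ℤ`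
(`ae_forall_mem_support`, `ae_hasDenseOrbit`). Such an `ω` has the largest possible spectrum:
`σ(ℰ_b) ⊆ σ(ℰ_ω)` for every `b` in `(supp ν)^ℤ` (`HasDenseOrbit.spectrum_subset`). Indeed `ℰ` is
unitary, so its spectrum is detected by approximate eigenvectors; one for `b` survives a small
change of coefficients, since `ℰ_a φ` is continuous in `a`, and can be carried back along an even
translation.

Any two good `ω` therefore have the same spectrum, which is `Σ_μ`. A periodization uses only values
of `ω`, so its spectrum lies in `Σ_μ`; periodizations converge pointwise to `ω`, so the same
continuity argument approximates each point of `Σ_μ`. No Floquet theory enters, and the parity of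
the period is irrelevant. -/

theorem isStarNormal_algebraMap_sub (A : H →L[ℂ] H) (hA : IsStarNormal A) (z : ℂ) :
    IsStarNormal (algebraMap ℂ (H →L[ℂ] H) z - A) := by
  rw [isStarNormal_iff]
  have h : Commute (star A) A := hA.star_comm_self
  rw [star_sub, ← algebraMap_star_comm]
  exact ((Algebra.commute_algebraMap_left _ _).sub_left
    (Algebra.commute_algebraMap_right _ _)).sub_right
    ((Algebra.commute_algebraMap_left _ _).sub_left h)

/-- Every point of the spectrum of a normal operator is an approximate eigenvalue. -/
theorem exists_norm_sub_lt_of_mem_spectrum {A : H →L[ℂ] H} (hA : IsStarNormal A) {z : ℂ}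
    (hz : z ∈ spectrum ℂ A) {ε : ℝ} (hε : 0 < ε) : ∃ φ : H, ‖z • φ - A φ‖ < ε * ‖φ‖ := by
  by_contra! h
  refine hz ?_
  have hN := isStarNormal_algebraMap_sub A hA z
  set T := algebraMap ℂ (H →L[ℂ] H) z - A with hT
  have hTφ : ∀ φ, T φ = z • φ - A φ := fun φ => by
    simp [hT, Algebra.algebraMap_eq_smul_one]
  have hb : ∀ φ, ‖φ‖ ≤ (ε⁻¹.toNNReal : ℝ) * ‖T φ‖ := fun φ => by
    rw [hTφ, Real.coe_toNNReal _ (by positivity), inv_mul_eq_div, le_div_iff₀ hε, mul_comm]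
    exact h φ
  rw [spectrum.mem_resolventSet_iff, ContinuousLinearMap.isUnit_iff_bijective,
    ContinuousLinearMap.bijective_iff_dense_range_and_antilipschitz]
  refine ⟨?_, _, T.antilipschitz_of_bound hb⟩
  -- For normal `T` the orthogonal complement of the range is the kernel, which the lower bound
  -- makes trivial.
  rw [Submodule.topologicalClosure_eq_top_iff, ContinuousLinearMap.IsStarNormal.orthogonal_range hN,
    eq_bot_iff]
  intro φ hφ
  have h0 : T φ = 0 := hφ
  have := hb φ
  rw [h0, norm_zero, mul_zero] at this
  simpa using this

/-- Near an approximate eigenvalue of a normal operator there is a point of the spectrum. -/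
theorem exists_mem_spectrum_of_norm_sub_lt {A : H →L[ℂ] H} (hA : IsStarNormal A) {z : ℂ}
    {ε : ℝ} {φ : H} (hφ : ‖z • φ - A φ‖ < ε * ‖φ‖) : ∃ w ∈ spectrum ℂ A, dist w z < ε := by
  by_contra! h
  have hφ0 : 0 < ‖φ‖ := by
    by_contra! h0
    rw [le_antisymm h0 (norm_nonneg _), mul_zero] at hφ
    exact absurd hφ (norm_nonneg _).not_gt
  have hε : 0 < ε := pos_of_mul_pos_left ((norm_nonneg _).trans_lt hφ) hφ0.le
  have hN := isStarNormal_algebraMap_sub A hA z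
  have hz : IsUnit (algebraMap ℂ (H →L[ℂ] H) z - A) := by
    by_contra hz
    have := h z hz
    rw [dist_self] at this
    linarith
  obtain ⟨u, hu⟩ := hz
  rw [← hu] at hN
  -- The spectrum of the inverse consists of the `(z - w)⁻¹` with `w ∈ σ(A)`. By normality the
  -- spectral radius is the norm, so `‖(z - A)⁻¹‖ ≤ ε⁻¹`, contradicting `hφ`.
  have hr : spectralRadius ℂ ((u⁻¹ : (H →L[ℂ] H)ˣ) : H →L[ℂ] H) ≤ ENNReal.ofReal ε⁻¹ := by
    refine iSup₂_le fun k hk => ?_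
    rw [← spectrum.map_inv, hu, ← spectrum.singleton_sub_eq, Set.mem_inv] at hk
    obtain ⟨z', hz', w, hw, hk⟩ := hk
    have hd := h w hw
    rw [dist_comm, dist_eq_norm] at hd
    have hk' : z - w = k⁻¹ := (congrArg (· - w) hz').symm.trans hk
    rw [hk', norm_inv] at hd
    rw [← enorm_eq_nnnorm, ← ofReal_norm]
    refine ENNReal.ofReal_le_ofReal ?_
    exact (le_inv_comm₀ hε (inv_pos.1 (hε.trans_le hd))).1 hd
  rw [IsStarNormal.spectralRadius_eq_nnnorm, ← enorm_eq_nnnorm, ← ofReal_norm,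
    ENNReal.ofReal_le_ofReal_iff (by positivity)] at hr
  have h1 : ((u⁻¹ : (H →L[ℂ] H)ˣ) : H →L[ℂ] H) ((u : H →L[ℂ] H) φ) = φ := by
    rw [← mul_apply_eq_comp, Units.inv_mul, one_apply_eq_self]
  have h2 : (u : H →L[ℂ] H) φ = z • φ - A φ := by
    simp [hu, Algebra.algebraMap_eq_smul_one]
  have h3 := ((u⁻¹ : (H →L[ℂ] H)ˣ) : H →L[ℂ] H).le_of_opNorm_le hr ((u : H →L[ℂ] H) φ)
  rw [h1, h2, inv_mul_eq_div, le_div_iff₀ hε] at h3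
  linarith

end Spectrum

/-! ### Unitarity through the factorization into `2 × 2` blocks -/

section Unitary

/-- The direct sum of the `2 × 2` blocks `(conj αₙ, ρₙ; ρₙ, -αₙ)` acting on the coordinates
`n, n + 1`, over the `n` that satisfy `P`. -/
def blockAction (P : ℤ → Prop) [DecidablePred P] (a : ℤ → Disk) (ψ : ℤ → ℂ) (n : ℤ) : ℂ :=
  if P n then star (a n : ℂ) * ψ n + rho (a n) * ψ (n + 1)
  else rho (a (n - 1)) * ψ (n - 1) - (a (n - 1) : ℂ) * ψ n

/-- The complex conjugate of a point of the disk. -/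
def conjDisk (w : Disk) : Disk :=
  ⟨star (w : ℂ), by simpa only [mem_ball_zero_iff, norm_star] using w.2⟩

theorem coe_conjDisk (w : Disk) : (conjDisk w : ℂ) = star (w : ℂ) := rfl

theorem conjDisk_conjDisk (w : Disk) : conjDisk (conjDisk w) = w :=
  Subtype.ext (star_star (w : ℂ))

theorem rho_conjDisk (w : Disk) : rho (conjDisk w) = rho w := by
  rw [rho, rho, coe_conjDisk, norm_star]

theorem sq_sqrt_rho (w : Disk) : Real.sqrt (1 - ‖(w : ℂ)‖ ^ 2) ^ 2 = 1 - ‖(w : ℂ)‖ ^ 2 :=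
  Real.sq_sqrt (by nlinarith [norm_coe_le w, norm_nonneg (w : ℂ)])

theorem rho_mul_self (w : Disk) : rho w * rho w = 1 - star (w : ℂ) * (w : ℂ) := by
  have h := congrArg (fun x : ℝ => (x : ℂ)) (sq_sqrt_rho w)
  simp only [Complex.ofReal_pow, Complex.ofReal_sub, Complex.ofReal_one] at h
  rw [← Complex.conj_mul' (w : ℂ)] at h
  rw [rho, ← pow_two, h]
  rfl

theorem norm_sq_block (w : Disk) (x y : ℂ) :
    ‖star (w : ℂ) * x + rho w * y‖ ^ 2 + ‖rho w * x - (w : ℂ) * y‖ ^ 2 = ‖x‖ ^ 2 + ‖y‖ ^ 2 := by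
  have h := sq_sqrt_rho w
  rw [rho]
  set r := Real.sqrt (1 - ‖(w : ℂ)‖ ^ 2)
  simp only [Complex.sq_norm, Complex.normSq_apply, Complex.add_re, Complex.add_im, Complex.mul_re,
    Complex.mul_im, Complex.sub_re, Complex.sub_im, Complex.ofReal_re, Complex.ofReal_im,
    Complex.star_def, Complex.conj_re, Complex.conj_im] at h ⊢
  linear_combination (x.re ^ 2 + x.im ^ 2 + y.re ^ 2 + y.im ^ 2) * h

variable {P : ℤ → Prop} [DecidablePred P]

/-- Each block is unitary and symmetric, so its inverse is its entrywise conjugate, i.e. the block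
of the conjugated coefficient. -/
theorem blockAction_conjDisk (hP : ∀ n, P (n + 1) ↔ ¬ P n) (a : ℤ → Disk) (ψ : ℤ → ℂ) :
    blockAction P (fun n => conjDisk (a n)) (blockAction P a ψ) = ψ := by
  funext n
  have hs := hP (n - 1)
  rw [sub_add_cancel] at hs
  by_cases h : P n
  · have h1 : ¬ P (n + 1) := by rw [hP]; simpa using h
    simp only [blockAction, h, h1, if_true, if_false, coe_conjDisk, rho_conjDisk, star_star,
      add_sub_cancel_right]
    linear_combination ψ n * rho_mul_self (a n)
  · have h1 : P (n - 1) := by tauto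
    simp only [blockAction, h, h1, if_true, if_false, coe_conjDisk, rho_conjDisk,
      sub_add_cancel]
    linear_combination ψ n * rho_mul_self (a (n - 1))

theorem blockAction_apply_conjDisk (hP : ∀ n, P (n + 1) ↔ ¬ P n) (a : ℤ → Disk) (ψ : ℤ → ℂ) :
    blockAction P a (blockAction P (fun n => conjDisk (a n)) ψ) = ψ := by
  simpa only [conjDisk_conjDisk] using blockAction_conjDisk hP (fun n => conjDisk (a n)) ψ

/-- The involution of `ℤ` that exchanges `n` and `n + 1` for every `n` satisfying `P`. -/
def pairSwap (P : ℤ → Prop) [DecidablePred P] (hP : ∀ n, P (n + 1) ↔ ¬ P n) : ℤ ≃ ℤ :=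
  Function.Involutive.toPerm (fun n => if P n then n + 1 else n - 1) fun n => by
    have hs := hP (n - 1)
    rw [sub_add_cancel] at hs
    by_cases h : P n
    · have h1 : ¬ P (n + 1) := by rw [hP]; simpa using h
      simp [h, h1]
    · have h1 : P (n - 1) := by tauto
      simp [h, h1]

theorem norm_sq_blockAction_pairSwap (hP : ∀ n, P (n + 1) ↔ ¬ P n) (a : ℤ → Disk) (ψ : ℤ → ℂ)
    (n : ℤ) :
    ‖blockAction P a ψ n‖ ^ 2 + ‖blockAction P a ψ (pairSwap P hP n)‖ ^ 2 =
      ‖ψ n‖ ^ 2 + ‖ψ (pairSwap P hP n)‖ ^ 2 := by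
  have hs := hP (n - 1)
  rw [sub_add_cancel] at hs
  have hdef : pairSwap P hP n = if P n then n + 1 else n - 1 := rfl
  by_cases h : P n
  · have h1 : ¬ P (n + 1) := by rw [hP]; simpa using h
    rw [hdef, if_pos h]
    simp only [blockAction, h, h1, if_true, if_false, add_sub_cancel_right]
    exact norm_sq_block _ _ _
  · have h1 : P (n - 1) := by tauto
    rw [hdef, if_neg h, add_comm, add_comm (‖ψ n‖ ^ 2)]
    simp only [blockAction, h, h1, if_true, if_false, sub_add_cancel]
    exact norm_sq_block _ _ _

theorem hasSum_norm_sq_blockAction (hP : ∀ n, P (n + 1) ↔ ¬ P n) (a : ℤ → Disk) {ψ : ℤ → ℂ}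
    {s : ℝ} (hψ : HasSum (fun n => ‖ψ n‖ ^ 2) s) :
    HasSum (fun n => ‖blockAction P a ψ n‖ ^ 2) s := by
  have hψ' : HasSum (fun n => ‖ψ (pairSwap P hP n)‖ ^ 2) s := (pairSwap P hP).hasSum_iff.mpr hψ
  have key := norm_sq_blockAction_pairSwap hP a ψ
  have hB : Summable fun n => ‖blockAction P a ψ n‖ ^ 2 :=
    Summable.of_nonneg_of_le (fun _ => by positivity)
      (fun n => (le_add_of_nonneg_right (by positivity)).trans (key n).le)
      (hψ.add hψ').summable
  obtain ⟨t, ht⟩ := hB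
  have ht' : HasSum (fun n => ‖blockAction P a ψ (pairSwap P hP n)‖ ^ 2) t :=
    (pairSwap P hP).hasSum_iff.mpr ht
  -- Norms agree on each pair `{n, n ± 1}` but not termwise; adding the swapped series counts every
  -- pair twice and gives `2t = 2s`.
  have hsum := ht.add ht'
  simp only [key] at hsum
  have := hsum.unique (hψ.add hψ')
  have hts : t = s := by linarith
  rwa [← hts]

theorem even_add_one_iff (n : ℤ) : Even (n + 1) ↔ ¬ Even n := Int.even_add_one

theorem not_even_add_one_iff (n : ℤ) : ¬ Even (n + 1) ↔ ¬ ¬ Even n := by rw [Int.even_add_one]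

/-- The factorization `ℰ = ℒℳ`, with blocks at even and at odd sites respectively. -/
theorem cmvAction_eq (a : ℤ → Disk) (ψ : ℤ → ℂ) :
    cmvAction a ψ =
      blockAction Even a (blockAction (fun n => ¬ Even n) a ψ) := by
  funext n
  have hs := even_add_one_iff (n - 1)
  rw [sub_add_cancel] at hs
  by_cases h : Even n
  · have h1 : ¬ Even (n + 1) := by rw [Int.even_add_one]; simpa using h
    simp only [cmvAction, blockAction, h, h1, if_true, if_false, not_true, not_false_eq_true,
      add_assoc]
    norm_num
    ring
  · have h1 : Even (n - 1) := by tauto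
    simp only [cmvAction, blockAction, h, h1, if_true, if_false, not_true, not_false_eq_true,
      sub_add_cancel, sub_sub]
    norm_num
    ring

theorem hasSum_norm_sq (ψ : EllTwo) : HasSum (fun n => ‖ψ n‖ ^ 2) (‖ψ‖ ^ 2) := by
  simpa using hasSum_shift ψ 0

theorem norm_extendedCMV (a : ℤ → Disk) (ψ : EllTwo) : ‖extendedCMV a ψ‖ = ‖ψ‖ := by
  have h := hasSum_norm_sq_blockAction even_add_one_iff a
    (hasSum_norm_sq_blockAction (P := fun n => ¬ Even n) not_even_add_one_iff a
      (hasSum_norm_sq ψ))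
  rw [← cmvAction_eq] at h
  exact (sq_eq_sq₀ (norm_nonneg _) (norm_nonneg _)).1 ((hasSum_norm_sq _).unique h)

theorem surjective_extendedCMV (a : ℤ → Disk) : Function.Surjective (extendedCMV a) := by
  intro φ
  have h := hasSum_norm_sq_blockAction (P := fun n => ¬ Even n) not_even_add_one_iff
    (fun n => conjDisk (a n))
    (hasSum_norm_sq_blockAction even_add_one_iff (fun n => conjDisk (a n)) (hasSum_norm_sq φ))
  refine ⟨⟨blockAction (fun n => ¬ Even n) (fun n => conjDisk (a n))
    (blockAction Even (fun n => conjDisk (a n)) φ), memℓp_gen (E := fun _ : ℤ => ℂ) (p := 2) (by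
      simpa only [ENNReal.toReal_ofNat, Real.rpow_ofNat] using h.summable)⟩, ?_⟩
  ext n
  rw [extendedCMV_apply, cmvAction_eq]
  simp only [blockAction_apply_conjDisk (P := fun n => ¬ Even n) not_even_add_one_iff,
    blockAction_apply_conjDisk even_add_one_iff]

theorem extendedCMV_mem_unitary (a : ℤ → Disk) :
    extendedCMV a ∈ unitary (EllTwo →L[ℂ] EllTwo) := by
  let e : EllTwo ≃ₗᵢ[ℂ] EllTwo := LinearIsometryEquiv.ofSurjective
    ⟨(extendedCMV a).toLinearMap, norm_extendedCMV a⟩ (surjective_extendedCMV a)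
  have : extendedCMV a = (Unitary.linearIsometryEquiv.symm e : EllTwo →L[ℂ] EllTwo) := rfl
  rw [this]
  exact (Unitary.linearIsometryEquiv.symm e).2

theorem isStarNormal_extendedCMV (a : ℤ → Disk) : IsStarNormal (extendedCMV a) := by
  have h := extendedCMV_mem_unitary a
  rw [Unitary.mem_iff] at h
  exact ⟨h.1.trans h.2.symm⟩

theorem spectrum_extendedCMV_subset (a : ℤ → Disk) :
    spectrum ℂ (extendedCMV a) ⊆ Metric.sphere (0 : ℂ) 1 :=
  spectrum.subset_circle_of_unitary (extendedCMV_mem_unitary a)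

end Unitary

/-! ### Strong continuity in the coefficients and dense orbits -/

section Continuity

theorem continuous_rho : Continuous rho := by
  unfold rho
  fun_prop

theorem continuous_cmvAction (ψ : ℤ → ℂ) (n : ℤ) : Continuous fun a => cmvAction a ψ n := by
  have hc : ∀ m : ℤ, Continuous fun a : ℤ → Disk => (a m : ℂ) := fun m =>
    continuous_subtype_val.comp (continuous_apply m)
  have hr : ∀ m : ℤ, Continuous fun a : ℤ → Disk => rho (a m) := fun m =>
    continuous_rho.comp (continuous_apply m)
  unfold cmvAction
  split_ifs <;> fun_prop

theorem continuous_extendedCMV_apply (ψ : EllTwo) : Continuous fun a => extendedCMV a ψ := by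
  rw [continuous_iff_continuousAt]
  intro b
  rw [ContinuousAt, tendsto_iff_norm_sub_tendsto_zero]
  have hsq : Tendsto (fun a => ∑' n, ‖cmvAction a ψ n - cmvAction b ψ n‖ ^ 2) (𝓝 b)
      (𝓝 (∑' _ : ℤ, (0 : ℝ))) := by
    -- The factor `4` is from `‖x - y‖² ≤ 2‖x‖² + 2‖y‖²`, both squares having the same band bound,
    -- uniform in the coefficients.
    refine tendsto_tsum_of_dominated_convergence ((hasSum_band ψ).summable.mul_left 4) ?_ ?_
    · intro n
      have : Tendsto (fun a => ‖cmvAction a ψ n - cmvAction b ψ n‖ ^ 2) (𝓝 b)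
          (𝓝 (‖cmvAction b ψ n - cmvAction b ψ n‖ ^ 2)) :=
        (((continuous_cmvAction ψ n).sub continuous_const).norm.pow 2).tendsto b
      simpa using this
    · refine Eventually.of_forall fun a n => ?_
      rw [Real.norm_of_nonneg (by positivity)]
      have h1 := norm_sq_cmvAction_le a ψ n
      have h2 := norm_sq_cmvAction_le b ψ n
      have h3 := pow_le_pow_left₀ (norm_nonneg _) (norm_sub_le (cmvAction a ψ n) (cmvAction b ψ n)) 2
      nlinarith [sq_nonneg (‖cmvAction a ψ n‖ - ‖cmvAction b ψ n‖)]
  rw [tsum_zero] at hsq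
  have h := hsq.sqrt
  rw [Real.sqrt_zero] at h
  refine h.congr fun a => ?_
  rw [← Real.sqrt_sq (norm_nonneg (extendedCMV a ψ - extendedCMV b ψ)),
    ← (hasSum_norm_sq (extendedCMV a ψ - extendedCMV b ψ)).tsum_eq]
  rfl

/-- Translating the coefficients by an even number does not create new approximate
eigenvectors. -/
theorem exists_norm_sub_eq_of_shift (a : ℤ → Disk) (m : ℤ) (z : ℂ) (φ : EllTwo) :
    ∃ φ' : EllTwo, ‖φ'‖ = ‖φ‖ ∧
      ‖z • φ' - extendedCMV a φ'‖ = ‖z • φ - extendedCMV (fun n => a (n + 2 * m)) φ‖ := by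
  have hs := hasSum_shift φ (-(2 * m))
  let φ' : EllTwo := ⟨fun n => φ (n + -(2 * m)),
    memℓp_gen (E := fun _ : ℤ => ℂ) (p := 2) (by simpa using hs.summable)⟩
  have hφ' : ∀ n, φ' n = φ (n + -(2 * m)) := fun _ => rfl
  refine ⟨φ', ?_, ?_⟩
  · exact (sq_eq_sq₀ (norm_nonneg _) (norm_nonneg _)).1 ((hasSum_norm_sq φ').unique hs)
  · have h1 := hasSum_norm_sq (z • φ' - extendedCMV a φ')
    have h2 := hasSum_shift (z • φ - extendedCMV (fun n => a (n + 2 * m)) φ) (-(2 * m))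
    refine (sq_eq_sq₀ (norm_nonneg _) (norm_nonneg _)).1 (h1.unique ?_)
    convert h2 using 4 with n
    simp only [lp.coeFn_sub, lp.coeFn_smul, Pi.sub_apply, Pi.smul_apply, extendedCMV_apply, hφ',
      cmvAction]
    -- Even shifts are needed here: an odd one would exchange the two types of rows.
    have he : Even (n + -(2 * m)) ↔ Even n := by
      simp [Int.even_add]
    simp only [he]
    have e1 : n + -(2 * m) + 2 * m = n := by ring
    have e2 : n + -(2 * m) - 1 + 2 * m = n - 1 := by ring
    have e3 : n + -(2 * m) + 1 + 2 * m = n + 1 := by ring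
    have e4 : n + -(2 * m) - 2 + 2 * m = n - 2 := by ring
    have e5 : n - 1 + -(2 * m) = n + -(2 * m) - 1 := by ring
    have e6 : n + 1 + -(2 * m) = n + -(2 * m) + 1 := by ring
    have e7 : n - 2 + -(2 * m) = n + -(2 * m) - 2 := by ring
    have e8 : n + 2 + -(2 * m) = n + -(2 * m) + 2 := by ring
    simp only [e1, e2, e3, e4, e5, e6, e7, e8]

/-- Strong convergence: a spectral value of `ℰ_b` is a limit of spectral values of `ℰ_a`
as `a → b`. -/
theorem eventually_exists_mem_spectrum {b : ℤ → Disk} {z : ℂ}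
    (hz : z ∈ spectrum ℂ (extendedCMV b)) {ε : ℝ} (hε : 0 < ε) :
    ∀ᶠ a in 𝓝 b, ∃ φ : EllTwo, ‖z • φ - extendedCMV a φ‖ < ε * ‖φ‖ := by
  obtain ⟨φ, hφ⟩ := exists_norm_sub_lt_of_mem_spectrum (isStarNormal_extendedCMV b) hz hε
  have hc : Continuous fun a => ‖z • φ - extendedCMV a φ‖ :=
    (continuous_const.sub (continuous_extendedCMV_apply φ)).norm
  filter_upwards [hc.tendsto b (Iio_mem_nhds hφ)] with a ha using ⟨φ, ha⟩

/-- The orbit of `a` under the even translations accumulates at every sequence in `K^ℤ`. -/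
def HasDenseOrbit (K : Set Disk) (a : ℤ → Disk) : Prop :=
  ∀ b : ℤ → Disk, (∀ n, b n ∈ K) → ∀ U : Set (ℤ → Disk), IsOpen U → b ∈ U →
    ∃ m : ℤ, (fun n => a (n + 2 * m)) ∈ U

theorem HasDenseOrbit.spectrum_subset {K : Set Disk} {a : ℤ → Disk} (ha : HasDenseOrbit K a)
    {b : ℤ → Disk} (hb : ∀ n, b n ∈ K) :
    spectrum ℂ (extendedCMV b) ⊆ spectrum ℂ (extendedCMV a) := by
  intro z hz
  rw [← (spectrum.isClosed (𝕜 := ℂ) (extendedCMV a)).closure_eq, Metric.mem_closure_iff]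
  intro ε hε
  obtain ⟨U, hU, hUo, hbU⟩ := mem_nhds_iff.1 (eventually_exists_mem_spectrum hz hε)
  obtain ⟨m, hm⟩ := ha b hb U hUo hbU
  obtain ⟨φ, hφ⟩ := hU hm
  obtain ⟨φ', h1, h2⟩ := exists_norm_sub_eq_of_shift a m z φ
  rw [← h1, ← h2] at hφ
  obtain ⟨w, hw, hwz⟩ := exists_mem_spectrum_of_norm_sub_lt (isStarNormal_extendedCMV a) hφ
  exact ⟨w, hw, by rwa [dist_comm]⟩

end Continuity

/-! ### Spectra of periodizations -/

section Periodization

theorem periodize_apply_of_mem (ω : ℤ → Disk) {l r : ℕ} {n : ℤ} (h1 : -(l : ℤ) ≤ n)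
    (h2 : n ≤ r) : periodize ω l r n = ω n := by
  rw [periodize, Int.emod_eq_of_lt (by omega) (by omega), add_sub_cancel_right]

theorem tendsto_periodize (ω : ℤ → Disk) {l r : ℕ → ℕ} (hl : Tendsto l atTop atTop)
    (hr : Tendsto r atTop atTop) :
    Tendsto (fun k => periodize ω (l k) (r k)) atTop (𝓝 ω) := by
  rw [tendsto_pi_nhds]
  intro n
  refine tendsto_const_nhds.congr' ?_
  filter_upwards [hl.eventually_ge_atTop n.natAbs, hr.eventually_ge_atTop n.natAbs] with k h1 h2
  exact (periodize_apply_of_mem ω (by omega) (by omega)).symm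

/-- If the even translates of `ω` are dense in `K^ℤ`, the spectra of the periodizations of `ω`
exhaust the spectrum of `ℰ_ω`. -/
theorem HasDenseOrbit.spectrum_eq_closure {K : Set Disk} {ω : ℤ → Disk}
    (hω : HasDenseOrbit K ω) (hK : ∀ n, ω n ∈ K) {l r : ℕ → ℕ} (hl : Tendsto l atTop atTop)
    (hr : Tendsto r atTop atTop) :
    spectrum ℂ (extendedCMV ω) =
      closure (⋃ k : ℕ, spectrum ℂ (extendedCMV (periodize ω (l k) (r k)))) := by
  refine subset_antisymm (fun z hz => ?_) (closure_minimal (Set.iUnion_subset fun k =>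
    hω.spectrum_subset fun n => hK _) (spectrum.isClosed _))
  rw [Metric.mem_closure_iff]
  intro ε hε
  obtain ⟨k, φ, hφ⟩ :=
    ((tendsto_periodize ω hl hr).eventually (eventually_exists_mem_spectrum hz hε)).exists
  obtain ⟨w, hw, hwz⟩ := exists_mem_spectrum_of_norm_sub_lt (isStarNormal_extendedCMV _) hφ
  exact ⟨w, Set.mem_iUnion.2 ⟨k, hw⟩, by rwa [dist_comm]⟩

end Periodization

/-! ### Almost sure density of orbits -/

section Probability

open ProbabilityTheory

/-- Under a product measure, boxes over disjoint sets of coordinates are independent events. -/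
theorem iIndepSet_pi_of_pairwise_disjoint {ι κ : Type*} {X : ι → Type*}
    [∀ i, MeasurableSpace (X i)] (μ : ∀ i, Measure (X i)) [∀ i, IsProbabilityMeasure (μ i)]
    {F : κ → Finset ι} (hF : Pairwise fun j k => Disjoint (F j) (F k)) {t : ∀ i, Set (X i)}
    (ht : ∀ i, MeasurableSet (t i)) :
    iIndepSet (fun j => Set.pi (F j : Set ι) t) (Measure.infinitePi μ) := by
  classical
  rw [iIndepSet_iff_meas_biInter fun j =>
    MeasurableSet.pi (F j).countable_toSet fun i _ => ht i]
  intro s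
  have h : (⋂ j ∈ s, Set.pi (F j : Set ι) t) = Set.pi (s.biUnion F : Set ι) t := by
    ext x
    simp only [Set.mem_iInter, Set.mem_pi, Finset.mem_coe, Finset.mem_biUnion]
    grind
  rw [h, Measure.infinitePi_pi μ fun i _ => ht i, Finset.prod_biUnion fun j _ k _ hjk => hF hjk]
  exact Finset.prod_congr rfl fun j _ => (Measure.infinitePi_pi μ fun i _ => ht i).symm

variable (ν : Measure Disk) [IsProbabilityMeasure ν]

/-- A box of positive measure over the window `{-N, …, N - 1}` is almost surely visited by an even
translate. -/
theorem ae_exists_shift_mem_box (N : ℕ) {t : ℤ → Set Disk}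
    (ht : ∀ i, MeasurableSet (t i)) (hpos : ∀ i, ν (t i) ≠ 0) :
    ∀ᵐ ω ∂(coeffLaw ν), ∃ m : ℤ, ∀ i ∈ Finset.Ico (-(N : ℤ)) N, ω (i + 2 * m) ∈ t i := by
  -- Translates of the window by multiples of its length `2N` are disjoint and even. `t'` repeats
  -- `t` with period `2N`, so all the boxes have one common positive measure.
  let F : ℕ → Finset ℤ := fun j => Finset.Ico (-(N : ℤ) + 2 * (N * j)) (N + 2 * (N * j))
  let t' : ℤ → Set Disk := fun m => t ((m + N) % (2 * N) - N)
  have hF : Pairwise fun j k => Disjoint (F j) (F k) := by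
    intro j k hjk
    rw [Finset.disjoint_left]
    intro x hx hy
    simp only [F, Finset.mem_Ico] at hx hy
    rcases Nat.lt_or_gt_of_ne hjk with h | h
    · have : (N : ℤ) * (j + 1) ≤ N * k := by exact_mod_cast Nat.mul_le_mul_left N h
      linarith
    · have : (N : ℤ) * (k + 1) ≤ N * j := by exact_mod_cast Nat.mul_le_mul_left N h
      linarith
  have ht' : ∀ i ∈ Finset.Ico (-(N : ℤ)) N, ∀ j : ℕ, t' (i + 2 * (N * j)) = t i := by
    intro i hi j
    rw [Finset.mem_Ico] at hi
    have : i + 2 * (N * (j : ℤ)) + N = i + N + 2 * N * j := by ring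
    simp only [t']
    rw [this, Int.add_mul_emod_self_left, Int.emod_eq_of_lt (by omega) (by omega),
      add_sub_cancel_right]
  have hFmap : ∀ j, F j = (Finset.Ico (-(N : ℤ)) N).map (addRightEmbedding (2 * (N * (j : ℤ)))) :=
    fun j => (Finset.map_add_right_Ico _ _ _).symm
  have hmeas : ∀ j, coeffLaw ν (Set.pi (F j : Set ℤ) t') =
      ∏ i ∈ Finset.Ico (-(N : ℤ)) N, ν (t i) := by
    intro j
    rw [coeffLaw, Measure.infinitePi_pi _ fun i _ => ht _, hFmap, Finset.prod_map]
    refine Finset.prod_congr rfl fun i hi => ?_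
    exact congrArg ν (ht' i hi j)
  -- Second Borel–Cantelli lemma: independent events with divergent total probability.
  have hlim := measure_limsup_eq_one (μ := coeffLaw ν)
    (s := fun j => Set.pi (F j : Set ℤ) t')
    (fun j => MeasurableSet.pi (F j).countable_toSet fun i _ => ht _)
    (iIndepSet_pi_of_pairwise_disjoint (fun _ : ℤ => ν) hF fun i => ht _) (by
      simp only [hmeas]
      exact ENNReal.tsum_const_eq_top_of_ne_zero (Finset.prod_ne_zero_iff.2 fun i _ => hpos i))
  have : IsProbabilityMeasure (coeffLaw ν) := by unfold coeffLaw; infer_instance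
  have hae : ∀ᵐ ω ∂(coeffLaw ν), ω ∈ limsup (fun j => Set.pi (F j : Set ℤ) t') atTop :=
    (prob_compl_eq_zero_iff (MeasurableSet.measurableSet_limsup fun j =>
      MeasurableSet.pi (F j).countable_toSet fun i _ => ht _)).2 hlim
  filter_upwards [hae] with ω hω
  rw [mem_limsup_iff_frequently_mem] at hω
  obtain ⟨j, hj⟩ := hω.exists
  refine ⟨N * j, fun i hi => ?_⟩
  rw [← ht' i hi j]
  refine hj _ ?_
  rw [hFmap]
  exact Finset.mem_coe.2 (Finset.mem_map.2 ⟨i, hi, rfl⟩)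

theorem ae_exists_shift_mem {U : Set (ℤ → Disk)} (hU : IsOpen U) {b : ℤ → Disk}
    (hb : ∀ n, b n ∈ ν.support) (hbU : b ∈ U) :
    ∀ᵐ ω ∂(coeffLaw ν), ∃ m : ℤ, (fun n => ω (n + 2 * m)) ∈ U := by
  classical
  obtain ⟨I, u, hu, hIU⟩ := isOpen_pi_iff.1 hU b hbU
  obtain ⟨N, hN⟩ : ∃ N : ℕ, ∀ i ∈ I, i.natAbs < N :=
    ⟨I.sup Int.natAbs + 1, fun i hi => Nat.lt_succ_of_le (Finset.le_sup hi)⟩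
  have h := ae_exists_shift_mem_box ν N
    (t := fun i => if i ∈ I then u i else Set.univ)
    (fun i => by
      split_ifs with hi
      · exact (hu i hi).1.measurableSet
      · exact MeasurableSet.univ)
    (fun i => by
      split_ifs with hi
      · exact ((Measure.mem_support_iff_forall _).1 (hb i) _ ((hu i hi).1.mem_nhds (hu i hi).2)).ne'
      · simp)
  filter_upwards [h] with ω hω
  obtain ⟨m, hm⟩ := hω
  refine ⟨m, hIU fun i hi => ?_⟩
  have := hm i (by have := hN i hi; rw [Finset.mem_Ico]; omega)
  rwa [if_pos (Finset.mem_coe.1 hi)] at this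

/-- A countable base leaves only countably many null sets to discard. -/
theorem ae_hasDenseOrbit : ∀ᵐ ω ∂(coeffLaw ν), HasDenseOrbit ν.support ω := by
  let B := TopologicalSpace.countableBasis (ℤ → Disk)
  have h : ∀ᵐ ω ∂(coeffLaw ν), ∀ U ∈ B, (∃ b ∈ U, ∀ n, b n ∈ ν.support) →
      ∃ m : ℤ, (fun n => ω (n + 2 * m)) ∈ U := by
    refine (ae_ball_iff (TopologicalSpace.countable_countableBasis _)).2 fun U hU => ?_
    by_cases hex : ∃ b ∈ U, ∀ n, b n ∈ ν.support
    · obtain ⟨b, hbU, hb⟩ := hex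
      filter_upwards [ae_exists_shift_mem ν
        (TopologicalSpace.isOpen_of_mem_countableBasis hU) hb hbU] with ω hω _ using hω
    · exact Eventually.of_forall fun ω h => absurd h hex
  filter_upwards [h] with ω hω b hb U hU hbU
  obtain ⟨V, hV, hbV, hVU⟩ :=
    (TopologicalSpace.isBasis_countableBasis (ℤ → Disk)).exists_subset_of_mem_open hbU hU
  obtain ⟨m, hm⟩ := hω V hV ⟨b, hbV, hb⟩
  exact ⟨m, hVU hm⟩

theorem ae_forall_mem_support : ∀ᵐ ω ∂(coeffLaw ν), ∀ n, ω n ∈ ν.support := by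
  rw [ae_all_iff]
  intro n
  exact (measurePreserving_eval_infinitePi (fun _ : ℤ => ν) n).quasiMeasurePreserving.ae
    Measure.support_mem_ae

end Probability

end RandomCMV

end

theorem corollary3p1 (ν : MeasureTheory.Measure RandomCMV.Disk)
    [MeasureTheory.IsProbabilityMeasure ν] (hν : IsCompact ν.support) :
    (∃! S : Set ℂ, RandomCMV.IsAlmostSureSpectrum ν S) ∧
    ∀ S : Set ℂ, RandomCMV.IsAlmostSureSpectrum ν S →
      ∀ l r : ℕ → ℕ, Monotone l → Filter.Tendsto l Filter.atTop Filter.atTop →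
        Monotone r → Filter.Tendsto r Filter.atTop Filter.atTop →
        ∀ᵐ ω ∂(RandomCMV.coeffLaw ν),
          S = closure (⋃ k : ℕ,
            spectrum ℂ (RandomCMV.extendedCMV (RandomCMV.periodize ω (l k) (r k)))) := by
  have : IsProbabilityMeasure (RandomCMV.coeffLaw ν) := by
    unfold RandomCMV.coeffLaw; infer_instance
  have hgood := (RandomCMV.ae_hasDenseOrbit ν).and (RandomCMV.ae_forall_mem_support ν)
  refine ⟨?_, fun S hS l r _ hl _ hr => ?_⟩
  · obtain ⟨ω₀, hd, hs⟩ := hgood.exists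
    refine ⟨spectrum ℂ (RandomCMV.extendedCMV ω₀), ⟨spectrum.isClosed _,
      RandomCMV.spectrum_extendedCMV_subset ω₀, ?_⟩, fun S hS => ?_⟩
    · filter_upwards [hgood] with ω hω
      exact subset_antisymm (hd.spectrum_subset hω.2) (hω.1.spectrum_subset hs)
    -- Uniqueness: two events of full measure share a point `ω`, whose spectrum is both `S` and that
    -- of `ω₀`.
    · obtain ⟨ω, hω, hωS⟩ := (hgood.and hS.2.2).exists
      rw [← hωS]
      exact subset_antisymm (hd.spectrum_subset hω.2) (hω.1.spectrum_subset hs)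
  · filter_upwards [hgood, hS.2.2] with ω hω hωS
    rw [← hωS]
    exact hω.1.spectrum_eq_closure hω.2 hl hr
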